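/- Let $1\le k\le d$, $t\ge 0$ and $n\ge 1$ be integers and let $\tau>0$. Let $\mathcal G_{k,d}=\{P\in\mathbb R^{d\times d}: P^\top=P,\ P^2=P,\ \operatorname{trace}(P)=k\}$ be the Grassmann space, let $\sigma_{k,d}$ be the orthogonally invariant Borel probability measure on $\mathcal G_{k,d}$ induced by the Haar measure on the orthogonal group $\mathcal O(d)$ (acting by $P\mapsto UPU^\top$), and let $\mathrm{Pol}_t(\mathcal G_{k,d})$ be the space of restrictions to $\mathcal G_{k,d}$ of polynomials of degree at most $t$ on the space of real symmetric $d\times d$ matrices. Put $K_t(P,Q)=\operatorname{trace}(PQ)^t$ for $P,Q\in\mathcal G_{k,d}$ (with $K_0=1$) and $$\lambda_t=\int_{\mathcal G_{k,d}}\int_{\mathcal G_{k,d}}K_t(P,Q)\,d\sigma_{k,d}(Q)\,d\sigma_{k,d}(P).$$ On $\mathrm{Pol}_t(\mathcal G_{k,d})=\operatorname{span}\{K_t(P,\cdot):P\in\mathcal G_{k,d}\}$ let $\|\cdot\|_{K_t}$ be the norm of the inner product $\langle f,g\rangle=\sum_{i,j}\alpha_i\beta_jK_t(P_i,Q_j)$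 for $f=\sum_i\alpha_iK_t(P_i,\cdot)$, $g=\sum_j\beta_jK_t(Q_j,\cdot)$. For $\varepsilon\ge 0$, points $P_1,\dots,P_n\in\mathcal G_{k,d}$ with weights $\omega_1,\dots,\omega_n\in\mathbb R$ form an $\varepsilon$-approximate cubature for $\mathrm{Pol}_t(\mathcal G_{k,d})$ with respect to $K_t$ if $$\sup_{f\in\mathrm{Pol}_t(\mathcal G_{k,d}),\ \|f\|_{K_t}=1}\Big|\sum_{j=1}^n\omega_jf(P_j)-\int_{\mathcal G_{k,d}}f\,d\sigma_{k,d}\Big|\le\varepsilon .$$ A Borel probability measure $\nu$ on $\mathcal G_{k,d}$ is a probabilistic cubature for $\mathrm{Pol}_t(\mathcal G_{k,d})$ if $\int f\,d\nu=\int f\,d\sigma_{k,d}$ for all $f\in\mathrm{Pol}_t(\mathcal G_{k,d})$. Let $\nu$ be a probabilistic cubature for $\mathrm{Pol}_t(\mathcal G_{k,d})$ and let $P_1,\dots,P_n$ be independent random elements of $\mathcal G_{k,d}$, each with law $\nu$. Then the event that $P_1,\dots,P_n$, with equal weights $\omega_j=1/n$, form a $\sqrt{\frac{(1+\tau^2)k^t-\lambda_t}{n}}$-approximate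 cubature for $\mathrm{Pol}_t(\mathcal G_{k,d})$ with respect to $K_t$ is measurable, and its probability is at least $1-4e^{-\Psi_\tau(n)}r_\tau(n)$, where $$\Psi_\tau(n)=\frac{\tau^2/2}{(1-\lambda_t/k^t)+\frac{\tau}{3\sqrt n}},\qquad r_\tau(n)=1+\frac{6}{n\tau^2\ln^2\!\Big(1+\frac{\tau}{\sqrt n\,(1-\lambda_t/k^t)}\Big)},$$ and where $r_\tau(n)$ is read as $1$ if $\lambda_t=k^t$ (that is, if $k=d$ or $t=0$). -/

import Mathlib

open MeasureTheory ProbabilityTheory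

noncomputable section

namespace GrassmannCubature

/-- The Grassmann space `𝒢_{k,d}` of symmetric idempotent real `d × d` matrices of trace `k`,
with the topology it inherits from the space of matrices. -/
abbrev Grassmannian (k d : ℕ) : Type :=
  {P : Matrix (Fin d) (Fin d) ℝ // P.transpose = P ∧ P * P = P ∧ P.trace = (k : ℝ)}

/-- The Grassmann space carries its Borel σ-algebra. -/
instance (k d : ℕ) : MeasurableSpace (Grassmannian k d) := borel _

instance (k d : ℕ) : BorelSpace (Grassmannian k d) := ⟨rfl⟩

/-- The orthogonal group `𝒪(d)`, with the topology it inherits from the space of matrices. -/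
abbrev OrthGroup (d : ℕ) : Type := Matrix.orthogonalGroup (Fin d) ℝ

instance (d : ℕ) : MeasurableSpace (OrthGroup d) := borel _

instance (d : ℕ) : BorelSpace (OrthGroup d) := ⟨rfl⟩

instance (d : ℕ) : CompactSpace (OrthGroup d) := by
  have hclosed : IsClosed (Matrix.orthogonalGroup (Fin d) ℝ : Set (Matrix (Fin d) (Fin d) ℝ)) :=
    isClosed_unitary
  have hbox : IsCompact
      (Set.univ.pi fun _ : Fin d => Set.univ.pi fun _ : Fin d => Set.Icc (-1 : ℝ) 1) :=
    isCompact_univ_pi fun _ => isCompact_univ_pi fun _ => isCompact_Icc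
  refine isCompact_iff_compactSpace.mp (hbox.of_isClosed_subset hclosed ?_)
  intro U hU i _ j _
  have h := entry_norm_bound_of_unitary (𝕜 := ℝ) hU i j
  rw [Real.norm_eq_abs] at h
  exact abs_le.mp h

/-- The Haar probability measure on the orthogonal group. -/
def haarOrth (d : ℕ) : Measure (OrthGroup d) :=
  Measure.haarMeasure ⊤

/-- The diagonal projection `D_k` with `k` ones followed by zeros. -/
def baseProj {k d : ℕ} (hkd : k ≤ d) : Grassmannian k d :=
  ⟨Matrix.diagonal fun i : Fin d => if (i : ℕ) < k then (1 : ℝ) else 0, by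
    refine ⟨Matrix.diagonal_transpose _, ?_, ?_⟩
    · simp [Matrix.diagonal_mul_diagonal]
    · rw [Matrix.trace_diagonal, Finset.sum_boole, Fin.card_filter_val_lt,
        Nat.min_eq_right hkd]⟩

/-- The action of `𝒪(d)` on `𝒢_{k,d}` by conjugation, `P ↦ U P Uᵀ`. -/
def conj {k d : ℕ} (U : OrthGroup d) (P : Grassmannian k d) : Grassmannian k d :=
  ⟨U.1 * P.1 * U.1.transpose, by
    have hU : U.1.transpose * U.1 = 1 := (Matrix.mem_orthogonalGroup_iff' (Fin d) ℝ).mp U.2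
    obtain ⟨h1, h2, h3⟩ := P.2
    refine ⟨?_, ?_, ?_⟩
    · simp only [Matrix.transpose_mul, Matrix.transpose_transpose, h1, Matrix.mul_assoc]
    · calc U.1 * P.1 * U.1.transpose * (U.1 * P.1 * U.1.transpose)
          = U.1 * P.1 * (U.1.transpose * U.1) * P.1 * U.1.transpose := by
            simp only [Matrix.mul_assoc]
        _ = U.1 * (P.1 * P.1) * U.1.transpose := by
            rw [hU]; simp only [Matrix.mul_assoc, Matrix.one_mul]
        _ = U.1 * P.1 * U.1.transpose := by rw [h2]
    · rw [Matrix.trace_mul_comm, ← Matrix.mul_assoc, hU, Matrix.one_mul, h3]⟩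

/-- The orthogonally invariant probability measure `σ_{k,d}` on `𝒢_{k,d}` that is induced by the
Haar measure on `𝒪(d)`: the law of `U D_k Uᵀ` for a Haar distributed `U`. -/
def sigma {k d : ℕ} (hkd : k ≤ d) : Measure (Grassmannian k d) :=
  (haarOrth d).map fun U => conj U (baseProj hkd)

/-- `Pol_t(𝒢_{k,d})`: the restrictions to `𝒢_{k,d}` of the polynomials of degree at most `t` in
the matrix entries. (The polynomial functions of degree at most `t` on the space of symmetric
matrices are exactly the restrictions of those on all matrices.) -/
def Pol (k d t : ℕ) : Submodule ℝ (Grassmannian k d → ℝ) :=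
  (MvPolynomial.restrictTotalDegree (Fin d × Fin d) ℝ t).map
    (LinearMap.pi fun P : Grassmannian k d =>
      (MvPolynomial.aeval fun ij : Fin d × Fin d => P.1 ij.1 ij.2 :
        MvPolynomial (Fin d × Fin d) ℝ →ₐ[ℝ] ℝ).toLinearMap)

/-- The kernel `K_t(P, Q) = ⟨P, Q⟩ ^ t`, where `⟨P, Q⟩ = trace (P Q)`. -/
def K {k d : ℕ} (t : ℕ) (P Q : Grassmannian k d) : ℝ :=
  (P.1 * Q.1).trace ^ t

/-- The function `∑ᵢ αᵢ K_t(Pᵢ, ·)`, for finitely many points with coefficients. -/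
def kernelSum {k d : ℕ} (t : ℕ) (α : Grassmannian k d →₀ ℝ) : Grassmannian k d → ℝ :=
  fun Q => α.sum fun P a => a * K t P Q

/-- The bilinear expression `∑ᵢⱼ αᵢ βⱼ K_t(Pᵢ, Qⱼ)`. -/
def kernelPairing {k d : ℕ} (t : ℕ) (α β : Grassmannian k d →₀ ℝ) : ℝ :=
  α.sum fun P a => β.sum fun Q b => a * b * K t P Q

open Classical in
/-- The inner product `⟨f, g⟩ = ∑ᵢⱼ αᵢ βⱼ K_t(Pᵢ, Qⱼ)` for `f = ∑ᵢ αᵢ K_t(Pᵢ, ·)` and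
`g = ∑ⱼ βⱼ K_t(Qⱼ, ·)`, which does not depend on the representations of `f` and `g`, see
`kernelInner_eq`. -/
def kernelInner {k d : ℕ} (t : ℕ) (f g : Grassmannian k d → ℝ) : ℝ :=
  if h : (∃ α, kernelSum t α = f) ∧ (∃ β, kernelSum t β = g) then
    kernelPairing t h.1.choose h.2.choose
  else 0

theorem kernelPairing_left {k d : ℕ} (t : ℕ) (α β : Grassmannian k d →₀ ℝ) :
    kernelPairing t α β = β.sum fun Q b => b * kernelSum t α Q := by
  simp only [kernelPairing, kernelSum, Finsupp.sum, Finset.mul_sum]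
  rw [Finset.sum_comm]
  exact Finset.sum_congr rfl fun Q _ => Finset.sum_congr rfl fun P _ => by ring

theorem kernelPairing_right {k d : ℕ} (t : ℕ) (α β : Grassmannian k d →₀ ℝ) :
    kernelPairing t α β = α.sum fun P a => a * kernelSum t β P := by
  simp only [kernelPairing, kernelSum, Finsupp.sum, Finset.mul_sum]
  refine Finset.sum_congr rfl fun P _ => Finset.sum_congr rfl fun Q _ => ?_
  rw [K, K, Matrix.trace_mul_comm]
  ring

theorem kernelInner_eq {k d : ℕ} (t : ℕ) (α β : Grassmannian k d →₀ ℝ) :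
    kernelInner t (kernelSum t α) (kernelSum t β) = kernelPairing t α β := by
  have h : (∃ α', kernelSum t α' = kernelSum t α) ∧ (∃ β', kernelSum t β' = kernelSum t β) :=
    ⟨⟨α, rfl⟩, ⟨β, rfl⟩⟩
  rw [kernelInner, dif_pos h, kernelPairing_left, h.1.choose_spec, ← kernelPairing_left,
    kernelPairing_right, h.2.choose_spec, ← kernelPairing_right]

/-- The norm `‖·‖_{K_t}` induced by the inner product. -/
def kernelNorm {k d : ℕ} (t : ℕ) (f : Grassmannian k d → ℝ) : ℝ :=
  Real.sqrt (kernelInner t f f)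

/-- `{(P_j, ω_j)}` is an `ε`-approximate cubature for `Pol_t(𝒢_{k,d})` with respect to `K_t`:
the supremum of the cubature error over all `f ∈ Pol_t(𝒢_{k,d})` with `‖f‖_{K_t} = 1` is at most
`ε`. -/
def IsApproxCubature {k d : ℕ} (hkd : k ≤ d) (t : ℕ) {n : ℕ} (P : Fin n → Grassmannian k d)
    (ω : Fin n → ℝ) (ε : ℝ) : Prop :=
  ∀ f ∈ Pol k d t, kernelNorm t f = 1 →
    |∑ j, ω j * f (P j) - ∫ Q, f Q ∂(sigma hkd)| ≤ ε

/-- A Borel probability measure on `𝒢_{k,d}` that integrates every `f ∈ Pol_t(𝒢_{k,d})` as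
`σ_{k,d}` does. -/
structure IsProbabilisticCubature {k d : ℕ} (hkd : k ≤ d) (t : ℕ)
    (ν : Measure (Grassmannian k d)) : Prop where
  isProbabilityMeasure : IsProbabilityMeasure ν
  integral_eq : ∀ f ∈ Pol k d t, ∫ Q, f Q ∂ν = ∫ Q, f Q ∂(sigma hkd)

/-- `λ_t`, the double integral of `K_t` with respect to `σ_{k,d}`. -/
def lam {k d : ℕ} (hkd : k ≤ d) (t : ℕ) : ℝ :=
  ∫ P, ∫ Q, K t P Q ∂(sigma hkd) ∂(sigma hkd)

/-- `Ψ_τ(n)`. -/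
def Psi {k d : ℕ} (hkd : k ≤ d) (t : ℕ) (τ : ℝ) (n : ℕ) : ℝ :=
  (τ ^ 2 / 2) / ((1 - lam hkd t / (k : ℝ) ^ t) + τ / (3 * Real.sqrt n))

/-- `r_τ(n)`. In the degenerate case `λ_t = k ^ t` (that is, `k = d` or `t = 0`) the logarithm in
the formula is infinite and the formula is read as its limit `1`. -/
def rTau {k d : ℕ} (hkd : k ≤ d) (t : ℕ) (τ : ℝ) (n : ℕ) : ℝ :=
  if lam hkd t = (k : ℝ) ^ t then 1
  else 1 + 6 / (n * τ ^ 2 *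
    Real.log (1 + τ / (Real.sqrt n * (1 - lam hkd t / (k : ℝ) ^ t))) ^ 2)

end GrassmannCubature

end

/-! ### Hoeffding's inequality in Hilbert space, by the hyperbolic cosine -/

namespace GrassmannCubature

/-! The tensor power `P^{⊗ t}` is a feature map for `K_t`, so by Cauchy-Schwarz the worst-case error
of equal weights is at most the norm of the average of the centred features. Because `𝒪(d)` acts
transitively, each centred feature has the same squared norm `c² = k^t - λ_t`
(`norm_feature_sub_meanFeature_sq`), and because `ν` is a cubature its mean under `ν` is zero.

For independent centred vectors of constant norm `c`, `measureReal_norm_sum_ge_le` gives the tail `2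
exp(-r² / (2 n c²))`. At `r = n ε` the exponent is `1/2 + τ² k^t / (2 (k^t - λ_t))`, which exceeds
`Ψ_τ(n)`. This is stronger than the stated bound, so `r_τ(n)` enters only through `r_τ(n) ≥ 1`.

The tail bound rests on the convexity of `z ↦ cosh √z`: its chord bounds `cosh (l ‖x + y‖)` by a
constant plus a term linear in `y`, which has mean zero. -/

theorem _root_.Real.cosh_sqrt_le_chord {a b u : ℝ} (ha : 0 < a) (hb : 0 < b) (hu : |u| ≤ a * b) :
    Real.cosh (Real.sqrt (a ^ 2 + b ^ 2 + 2 * u)) ≤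
      Real.cosh a * Real.cosh b + u / (a * b) * (Real.sinh a * Real.sinh b) := by
  have hab : 0 < a * b := mul_pos ha hb
  obtain ⟨hu1, hu2⟩ := abs_le.mp hu
  have hz : 0 ≤ a ^ 2 + b ^ 2 + 2 * u := by nlinarith [sq_nonneg (a - b)]
  -- Weights placing `a² + b² + 2u` between the endpoints `(a + b)²` and `(a - b)²`.
  set p : ℝ := (1 + u / (a * b)) / 2 with hp
  set q : ℝ := (1 - u / (a * b)) / 2 with hq
  have hp0 : 0 ≤ p := by
    have : -1 ≤ u / (a * b) := by rw [le_div_iff₀ hab]; linarith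
    rw [hp]; linarith
  have hq0 : 0 ≤ q := by
    have : u / (a * b) ≤ 1 := by rw [div_le_iff₀ hab]; linarith
    rw [hq]; linarith
  have hpq : p + q = 1 := by rw [hp, hq]; ring
  have hconv : a ^ 2 + b ^ 2 + 2 * u = p * (a + b) ^ 2 + q * (a - b) ^ 2 := by
    rw [hp, hq]; field_simp; ring
  have hS : HasSum (fun m : ℕ => p * ((a + b) ^ (2 * m) / ((2 * m).factorial : ℝ))
      + q * ((a - b) ^ (2 * m) / ((2 * m).factorial : ℝ)))
      (p * Real.cosh (a + b) + q * Real.cosh (a - b)) :=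
    ((Real.hasSum_cosh (a + b)).mul_left p).add ((Real.hasSum_cosh (a - b)).mul_left q)
  have hle := hasSum_le (fun m => ?_) (Real.hasSum_cosh (Real.sqrt (a ^ 2 + b ^ 2 + 2 * u))) hS
  · refine hle.trans_eq ?_
    rw [Real.cosh_add, Real.cosh_sub, hp, hq]; ring
  -- Termwise convexity: `cosh √z = ∑ z^m / (2m)!`, and each `z^m` is convex on `z ≥ 0`.
  · have h := (convexOn_pow (𝕜 := ℝ) m).2 (Set.mem_Ici.mpr (sq_nonneg (a + b)))
      (Set.mem_Ici.mpr (sq_nonneg (a - b))) hp0 hq0 hpq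
    simp only [smul_eq_mul] at h
    rw [pow_mul, Real.sq_sqrt hz, hconv, pow_mul, pow_mul, ← mul_div_assoc, ← mul_div_assoc,
      ← add_div]
    gcongr

section Hoeffding

variable {E : Type*} [NormedAddCommGroup E] [InnerProductSpace ℝ E]

/-- The chord bound with `a = l‖x‖`, `b = lc`, `u = l²⟨x, y⟩`. The vector paired with `y` depends on
`x` alone, so independence can remove that term. At `x = 0` it vanishes and equality holds. -/
theorem cosh_norm_add_le {x y : E} {l c : ℝ} (hl : 0 < l) (hc : 0 < c) (hy : ‖y‖ = c) :
    Real.cosh (l * ‖x + y‖) ≤ Real.cosh (l * c) * Real.cosh (l * ‖x‖) +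
      inner ℝ ((Real.sinh (l * ‖x‖) * Real.sinh (l * c) / (‖x‖ * c)) • x) y := by
  rcases eq_or_ne x 0 with rfl | hx
  · simp [hy]
  have hx0 : 0 < ‖x‖ := norm_pos_iff.mpr hx
  have hu : |l ^ 2 * inner ℝ x y| ≤ (l * ‖x‖) * (l * c) := by
    rw [abs_mul, abs_of_nonneg (sq_nonneg l), ← hy]
    nlinarith [abs_real_inner_le_norm x y, sq_nonneg l]
  have h := Real.cosh_sqrt_le_chord (mul_pos hl hx0) (mul_pos hl hc) hu
  have hn : (l * ‖x‖) ^ 2 + (l * c) ^ 2 + 2 * (l ^ 2 * inner ℝ x y) = (l * ‖x + y‖) ^ 2 := by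
    rw [mul_pow l ‖x + y‖, norm_add_sq_real, hy]; ring
  rw [hn, Real.sqrt_sq (by positivity)] at h
  refine h.trans_eq ?_
  rw [real_inner_smul_left]
  field_simp

variable [CompleteSpace E] [SecondCountableTopology E] [MeasurableSpace E] [BorelSpace E]
  {Ω : Type*} [MeasurableSpace Ω] {μ : Measure Ω} [IsProbabilityMeasure μ]

theorem integrable_of_measurable_of_norm_le {F : Type*} [NormedAddCommGroup F]
    [SecondCountableTopology F] [MeasurableSpace F] [BorelSpace F] {f : Ω → F}
    (hf : Measurable f) {C : ℝ} (h : ∀ x, ‖f x‖ ≤ C) : Integrable f μ :=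
  Integrable.of_bound hf.aestronglyMeasurable C (ae_of_all _ h)

omit [InnerProductSpace ℝ E] [CompleteSpace E] [SecondCountableTopology E] in
theorem integrable_cosh_norm {f : Ω → E} (hf : Measurable f) {C : ℝ} (h : ∀ x, ‖f x‖ ≤ C)
    {l : ℝ} (hl : 0 < l) : Integrable (fun x => Real.cosh (l * ‖f x‖)) μ := by
  refine integrable_of_measurable_of_norm_le (by fun_prop) (C := Real.cosh (l * C)) fun x => ?_
  rw [Real.norm_eq_abs, abs_of_pos (Real.cosh_pos _), Real.cosh_le_cosh, abs_of_nonneg (by positivity),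
    abs_of_nonneg (mul_nonneg hl.le ((norm_nonneg _).trans (h x)))]
  exact mul_le_mul_of_nonneg_left (h x) hl.le

theorem integral_cosh_norm_add_le {S Y : Ω → E} (hS : Measurable S) (hY : Measurable Y)
    (hSY : S ⟂ᵢ[μ] Y) {l c C : ℝ} (hl : 0 < l) (hc : 0 < c) (hYc : ∀ x, ‖Y x‖ = c)
    (hSC : ∀ x, ‖S x‖ ≤ C) (hY0 : ∫ x, Y x ∂μ = 0) :
    ∫ x, Real.cosh (l * ‖S x + Y x‖) ∂μ ≤
      Real.cosh (l * c) * ∫ x, Real.cosh (l * ‖S x‖) ∂μ := by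
  let g : E → E := fun v => (Real.sinh (l * ‖v‖) * Real.sinh (l * c) / (‖v‖ * c)) • v
  have hg : Measurable g := by
    refine Measurable.smul ?_ measurable_id
    have : Measurable fun v : E => Real.sinh (l * ‖v‖) :=
      Real.measurable_sinh.comp (by fun_prop)
    fun_prop
  have hgb : ∀ x, ‖g (S x)‖ ≤ Real.sinh (l * C) * Real.sinh (l * c) / c := by
    intro x
    have hC : 0 ≤ C := (norm_nonneg _).trans (hSC x)
    have h1 : 0 ≤ Real.sinh (l * c) := Real.sinh_nonneg_iff.mpr (by positivity)
    have h2 : 0 ≤ Real.sinh (l * ‖S x‖) := Real.sinh_nonneg_iff.mpr (by positivity)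
    have h3 : 0 ≤ Real.sinh (l * C) := Real.sinh_nonneg_iff.mpr (by positivity)
    rcases eq_or_ne (S x) 0 with hx | hx
    · simp only [g, hx, smul_zero, norm_zero]; positivity
    · have hx0 : 0 < ‖S x‖ := norm_pos_iff.mpr hx
      simp only [g]
      rw [norm_smul, Real.norm_eq_abs, abs_of_nonneg (by positivity)]
      have : Real.sinh (l * ‖S x‖) * Real.sinh (l * c) / (‖S x‖ * c) * ‖S x‖ =
          Real.sinh (l * ‖S x‖) * Real.sinh (l * c) / c := by field_simp
      rw [this]
      gcongr
      exact Real.sinh_le_sinh.mpr (mul_le_mul_of_nonneg_left (hSC x) hl.le)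
  have hgi : Integrable (fun x => g (S x)) μ :=
    integrable_of_measurable_of_norm_le (hg.comp hS) hgb
  have hYi : Integrable Y μ := integrable_of_measurable_of_norm_le hY fun x => (hYc x).le
  -- Independence factors the mean of the linear term through `∫ Y = 0`.
  have hind : (fun x => g (S x)) ⟂ᵢ[μ] Y := hSY.comp hg measurable_id
  have hin : ∫ x, inner ℝ (g (S x)) (Y x) ∂μ = 0 := by
    have := hind.integral_bilin hgi hYi (innerSL ℝ)
    rw [hY0, map_zero] at this
    exact this
  have hini : Integrable (fun x => inner ℝ (g (S x)) (Y x)) μ := by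
    refine integrable_of_measurable_of_norm_le ((hg.comp hS).inner hY)
      (C := Real.sinh (l * C) * Real.sinh (l * c) / c * c) fun x => ?_
    refine (norm_inner_le_norm _ _).trans ?_
    rw [hYc x]
    exact mul_le_mul_of_nonneg_right (hgb x) hc.le
  have hcs := integrable_cosh_norm (μ := μ) hS hSC hl
  calc ∫ x, Real.cosh (l * ‖S x + Y x‖) ∂μ
      ≤ ∫ x, (Real.cosh (l * c) * Real.cosh (l * ‖S x‖) + inner ℝ (g (S x)) (Y x)) ∂μ := by
        refine integral_mono (integrable_cosh_norm (hS.add hY) (C := C + c) (fun x => ?_) hl)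
          ((hcs.const_mul _).add hini) fun x => cosh_norm_add_le hl hc (hYc x)
        exact (norm_add_le _ _).trans (add_le_add (hSC x) (hYc x).le)
    _ = _ := by
        rw [integral_add (hcs.const_mul _) hini, hin, add_zero, integral_const_mul]

theorem integral_cosh_norm_sum_le {ι : Type*} {Y : ι → Ω → E} (hY : ∀ i, Measurable (Y i))
    (hind : iIndepFun Y μ) {l c : ℝ} (hl : 0 < l) (hc : 0 < c) (hYc : ∀ i x, ‖Y i x‖ = c)
    (hY0 : ∀ i, ∫ x, Y i x ∂μ = 0) (s : Finset ι) :
    ∫ x, Real.cosh (l * ‖∑ i ∈ s, Y i x‖) ∂μ ≤ Real.cosh (l * c) ^ s.card := by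
  classical
  induction s using Finset.induction_on with
  | empty => simp
  | insert i s his ih =>
    have hSm : Measurable fun x => ∑ j ∈ s, Y j x := Finset.measurable_sum s fun j _ => hY j
    have hSi : (fun x => ∑ j ∈ s, Y j x) ⟂ᵢ[μ] Y i := by
      have := hind.indepFun_finsetSum_of_notMem hY his
      convert! this using 1
      ext x; simp
    have hb : ∀ x, ‖∑ j ∈ s, Y j x‖ ≤ s.card * c := fun x => by
      refine (norm_sum_le _ _).trans ?_
      simp [hYc]
    have := integral_cosh_norm_add_le hSm (hY i) hSi hl hc (hYc i) hb (hY0 i)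
    rw [Finset.card_insert_of_notMem his, pow_succ']
    simp_rw [Finset.sum_insert his, add_comm (Y i _)]
    exact this.trans (mul_le_mul_of_nonneg_left ih (Real.cosh_pos _).le)

/-- **Hoeffding's inequality in Hilbert space** for independent centred random vectors of constant
norm. -/
theorem measureReal_norm_sum_ge_le {n : ℕ} (hn : 0 < n) {Y : Fin n → Ω → E}
    (hY : ∀ i, Measurable (Y i)) (hind : iIndepFun Y μ) {c r : ℝ} (hr : 0 < r) (hc : 0 < c)
    (hYc : ∀ i x, ‖Y i x‖ = c) (hY0 : ∀ i, ∫ x, Y i x ∂μ = 0) :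
    μ.real {x | r ≤ ‖∑ i, Y i x‖} ≤ 2 * Real.exp (-(r ^ 2 / (2 * n * c ^ 2))) := by
  have hn' : (0 : ℝ) < n := by exact_mod_cast hn
  -- The minimiser of the Chernoff exponent `n l² c² / 2 - l r`.
  set l : ℝ := r / (n * c ^ 2) with hl_def
  have hl : 0 < l := by positivity
  have hSm : Measurable fun x => ∑ j, Y j x := Finset.measurable_sum _ fun j _ => hY j
  have hb : ∀ x, ‖∑ j, Y j x‖ ≤ n * c := fun x => by
    refine (norm_sum_le _ _).trans ?_
    simp [hYc]
  have hexp : ∫ x, Real.cosh (l * ‖∑ i, Y i x‖) ∂μ ≤ Real.exp (n * ((l * c) ^ 2 / 2)) := by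
    refine (integral_cosh_norm_sum_le hY hind hl hc hYc hY0 Finset.univ).trans ?_
    rw [Finset.card_univ, Fintype.card_fin, Real.exp_nat_mul]
    exact pow_le_pow_left₀ (Real.cosh_pos _).le (Real.cosh_le_exp_half_sq _) n
  have hmarkov := mul_meas_ge_le_integral_of_nonneg (μ := μ)
    (ae_of_all _ fun x => (Real.cosh_pos (l * ‖∑ i, Y i x‖)).le)
    (integrable_cosh_norm hSm hb hl) (Real.cosh (l * r))
  have hset : {x | r ≤ ‖∑ i, Y i x‖} = {x | Real.cosh (l * r) ≤ Real.cosh (l * ‖∑ i, Y i x‖)} := by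
    ext x
    simp only [Set.mem_ofPred_eq]
    rw [Real.cosh_le_cosh, abs_of_nonneg (by positivity), abs_of_nonneg (by positivity),
      mul_le_mul_iff_right₀ hl]
  rw [← hset] at hmarkov
  have hcosh : Real.exp (l * r) / 2 ≤ Real.cosh (l * r) := by
    rw [Real.cosh_eq]; linarith [Real.exp_pos (-(l * r))]
  have h1 : Real.exp (l * r) / 2 * μ.real {x | r ≤ ‖∑ i, Y i x‖} ≤
      Real.exp (n * ((l * c) ^ 2 / 2)) :=
    (mul_le_mul_of_nonneg_right hcosh measureReal_nonneg).trans (hmarkov.trans hexp)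
  have h2 : -(r ^ 2 / (2 * n * c ^ 2)) = n * ((l * c) ^ 2 / 2) - l * r := by
    rw [hl_def]; field_simp; ring
  rw [h2, Real.exp_sub, ← mul_div_assoc, le_div_iff₀ (Real.exp_pos _)]
  linarith

end Hoeffding

end GrassmannCubature

/-! ### Transitivity of the orthogonal action -/

namespace GrassmannCubature

section Transitivity

-- The eigenvalues of a projection are 0 or 1, and the trace counts the ones.
open Polynomial in
theorem charpoly_eq_of_isHermitian_of_mul_self {d k : ℕ} {P : Matrix (Fin d) (Fin d) ℝ}
    (hP : P.IsHermitian) (hPP : P * P = P) (htr : P.trace = k) :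
    P.charpoly = (X - C 1) ^ k * X ^ (d - k) := by
  classical
  have hdiag := hP.conjStarAlgAut_star_eigenvectorUnitary
  have hsq : ∀ i, hP.eigenvalues i * hP.eigenvalues i = hP.eigenvalues i := by
    intro i
    have h := congrArg (Unitary.conjStarAlgAut ℝ _ (star hP.eigenvectorUnitary)) hPP
    rw [map_mul, hdiag, Matrix.diagonal_mul_diagonal] at h
    simpa using congrFun (Matrix.diagonal_injective h) i
  have h01 : ∀ i, hP.eigenvalues i = if hP.eigenvalues i = 1 then 1 else 0 := by
    intro i
    split_ifs with h
    · exact h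
    · by_contra h0
      exact h (mul_left_cancel₀ h0 ((hsq i).trans (mul_one _).symm))
  have hcard : (Finset.univ.filter fun i => hP.eigenvalues i = 1).card = k := by
    have h := hP.trace_eq_sum_eigenvalues
    rw [htr, Finset.sum_congr rfl fun i _ => by rw [h01 i]] at h
    simp only [RCLike.ofReal_real_eq_id, id_eq, Finset.sum_boole] at h
    exact_mod_cast h.symm
  have hcard' : (Finset.univ.filter fun i => ¬ hP.eigenvalues i = 1).card = d - k := by
    have h := Finset.card_filter_add_card_filter_not (s := (Finset.univ : Finset (Fin d)))
      (fun i => hP.eigenvalues i = 1)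
    rw [Finset.card_univ, Fintype.card_fin] at h
    omega
  rw [hP.charpoly_eq, ← Finset.prod_filter_mul_prod_filter_not Finset.univ
    fun i => hP.eigenvalues i = 1]
  congr 1
  · rw [← hcard, ← Finset.prod_const]
    refine Finset.prod_congr rfl fun i hi => ?_
    rw [(Finset.mem_filter.mp hi).2]; simp
  · rw [← hcard', ← Finset.prod_const]
    refine Finset.prod_congr rfl fun i hi => ?_
    rw [h01 i, if_neg (Finset.mem_filter.mp hi).2]; simp

theorem Grassmannian.isHermitian {k d : ℕ} (P : Grassmannian k d) : P.1.IsHermitian := by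
  rw [Matrix.IsHermitian, Matrix.conjTranspose_eq_transpose_of_trivial]
  exact P.2.1

/-- The orthogonal group acts transitively on the Grassmann space. -/
theorem exists_conj_eq {k d : ℕ} (P Q : Grassmannian k d) : ∃ U : OrthGroup d, conj U P = Q := by
  have hP := P.isHermitian
  have hQ := Q.isHermitian
  have hev : hP.eigenvalues = hQ.eigenvalues := by
    rw [Matrix.IsHermitian.eigenvalues_eq_eigenvalues_iff,
      charpoly_eq_of_isHermitian_of_mul_self hP P.2.2.1 P.2.2.2,
      charpoly_eq_of_isHermitian_of_mul_self hQ Q.2.2.1 Q.2.2.2]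
  have h1 := hP.conjStarAlgAut_star_eigenvectorUnitary
  have h2 := hQ.spectral_theorem
  rw [← hev, ← h1, Unitary.conjStarAlgAut_apply, Unitary.conjStarAlgAut_apply] at h2
  -- With equal ordered spectra, mapping the eigenbasis of `P` to that of `Q` carries `P` to `Q`.
  refine ⟨hQ.eigenvectorUnitary * star hP.eigenvectorUnitary, Subtype.ext ?_⟩
  refine Eq.trans ?_ h2.symm
  simp only [conj, Submonoid.coe_mul, Unitary.coe_star, Matrix.star_eq_conjTranspose,
    Matrix.conjTranspose_eq_transpose_of_trivial, Matrix.transpose_mul,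
    Matrix.transpose_transpose, Matrix.mul_assoc]

end Transitivity

/-! ### Compactness, invariance of `σ_{k,d}` and constancy of the kernel mean -/

section Topology

variable {k d : ℕ}

/-- Since `P = P Pᵀ`, the diagonal entry `P a a` is the squared norm of row `a`. -/
theorem abs_entry_le (P : Grassmannian k d) (i j : Fin d) : |P.1 i j| ≤ 1 := by
  have h : ∀ a b, P.1 a b ^ 2 ≤ P.1 a a := by
    intro a b
    have hsq := congrFun (congrFun P.2.2.1 a) a
    rw [Matrix.mul_apply] at hsq
    have hsym : ∀ x, P.1 x a = P.1 a x := fun x => congrFun (congrFun P.2.1 a) x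
    rw [← hsq, Finset.sum_congr rfl fun x _ => by rw [hsym x, ← pow_two]]
    exact Finset.single_le_sum (f := fun x => P.1 a x ^ 2) (fun x _ => sq_nonneg _)
      (Finset.mem_univ b)
  have h1 : P.1 i i ≤ 1 := by nlinarith [h i i, sq_nonneg (P.1 i i - 1)]
  rw [← sq_le_one_iff_abs_le_one]
  exact (h i j).trans h1

theorem continuous_entry (i j : Fin d) : Continuous fun P : Grassmannian k d => P.1 i j :=
  (continuous_apply j).comp ((continuous_apply i).comp continuous_subtype_val)

instance : CompactSpace (Grassmannian k d) := by
  have hclosed : IsClosed {P : Matrix (Fin d) (Fin d) ℝ |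
      P.transpose = P ∧ P * P = P ∧ P.trace = (k : ℝ)} := by
    refine (isClosed_eq (by fun_prop) (by fun_prop)).inter
      ((isClosed_eq (by fun_prop) (by fun_prop)).inter (isClosed_eq (by fun_prop) (by fun_prop)))
  have hbox : IsCompact
      (Set.univ.pi fun _ : Fin d => Set.univ.pi fun _ : Fin d => Set.Icc (-1 : ℝ) 1) :=
    isCompact_univ_pi fun _ => isCompact_univ_pi fun _ => isCompact_Icc
  refine isCompact_iff_compactSpace.mp (hbox.of_isClosed_subset hclosed ?_)
  intro P hP i _ j _
  exact abs_le.mp (abs_entry_le ⟨P, hP⟩ i j)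

instance : SecondCountableTopology (Grassmannian k d) := by
  have : SecondCountableTopology (Matrix (Fin d) (Fin d) ℝ) :=
    inferInstanceAs (SecondCountableTopology (Fin d → Fin d → ℝ))
  exact Topology.IsInducing.subtypeVal.secondCountableTopology

theorem integrable_of_continuous {F : Type*} [NormedAddCommGroup F]
    {f : Grassmannian k d → F} (hf : Continuous f) (ν : Measure (Grassmannian k d))
    [IsFiniteMeasure ν] : Integrable f ν :=
  hf.integrable_of_hasCompactSupport (HasCompactSupport.of_compactSpace f)

theorem continuous_of_mem_Pol {t : ℕ} {f : Grassmannian k d → ℝ} (hf : f ∈ Pol k d t) :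
    Continuous f := by
  obtain ⟨p, -, rfl⟩ := hf
  change Continuous fun P : Grassmannian k d =>
    MvPolynomial.aeval (fun ij : Fin d × Fin d => P.1 ij.1 ij.2) p
  simp only [MvPolynomial.aeval_def, MvPolynomial.eval₂_eq]
  refine continuous_finsetSum _ fun m _ => continuous_const.mul ?_
  exact continuous_finsetProd _ fun ij _ => (continuous_entry ij.1 ij.2).pow _

theorem continuous_conj_left (P : Grassmannian k d) :
    Continuous fun U : OrthGroup d => conj U P := by
  refine Continuous.subtype_mk ?_ _
  have : Continuous fun U : OrthGroup d => U.1 := continuous_subtype_val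
  fun_prop

theorem continuous_conj_right (U : OrthGroup d) :
    Continuous fun P : Grassmannian k d => conj U P := by
  refine Continuous.subtype_mk ?_ _
  have : Continuous fun P : Grassmannian k d => P.1 := continuous_subtype_val
  fun_prop

theorem conj_conj (U V : OrthGroup d) (P : Grassmannian k d) :
    conj U (conj V P) = conj (U * V) P := by
  apply Subtype.ext
  simp only [conj, Submonoid.coe_mul, Matrix.transpose_mul, Matrix.mul_assoc]

instance : IsProbabilityMeasure (haarOrth d) := by
  constructor
  have := Measure.haarMeasure_self (K₀ := (⊤ : TopologicalSpace.PositiveCompacts (OrthGroup d)))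
  simpa [haarOrth] using this

instance : (haarOrth d).IsMulLeftInvariant := by
  unfold haarOrth; infer_instance

instance (hkd : k ≤ d) : IsProbabilityMeasure (sigma hkd) :=
  Measure.isProbabilityMeasure_map (continuous_conj_left _).measurable.aemeasurable

theorem map_conj_sigma (hkd : k ≤ d) (U : OrthGroup d) :
    (sigma hkd).map (fun P => conj U P) = sigma hkd := by
  rw [sigma, Measure.map_map (continuous_conj_right U).measurable
    (continuous_conj_left _).measurable]
  conv_rhs => rw [← map_mul_left_eq_self (haarOrth d) U]
  rw [Measure.map_map (continuous_conj_left _).measurable (measurable_const_mul U)]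
  congr 1
  ext1 V
  exact conj_conj U V _

theorem K_conj_conj (t : ℕ) (U : OrthGroup d) (P Q : Grassmannian k d) :
    K t (conj U P) (conj U Q) = K t P Q := by
  have hU : U.1.transpose * U.1 = 1 := (Matrix.mem_orthogonalGroup_iff' (Fin d) ℝ).mp U.2
  have h : U.1 * P.1 * U.1.transpose * (U.1 * Q.1 * U.1.transpose) =
      U.1 * (P.1 * Q.1 * U.1.transpose) := by
    calc _ = U.1 * P.1 * (U.1.transpose * U.1) * Q.1 * U.1.transpose := by
            simp only [Matrix.mul_assoc]
      _ = _ := by rw [hU, Matrix.mul_one]; simp only [Matrix.mul_assoc]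
  simp only [K, conj]
  rw [h, Matrix.trace_mul_comm, Matrix.mul_assoc, hU, Matrix.mul_one]

theorem continuous_K (t : ℕ) (P : Grassmannian k d) : Continuous (K t P) := by
  have : Continuous fun Q : Grassmannian k d => Q.1 := continuous_subtype_val
  unfold K
  fun_prop

theorem K_self (t : ℕ) (P : Grassmannian k d) : K t P P = (k : ℝ) ^ t := by
  rw [K, P.2.2.1, P.2.2.2]

/-- By transitivity and the invariance of `K_t` and `σ_{k,d}`, the inner integral does not depend on
`P`. -/
theorem integral_K_eq_lam (hkd : k ≤ d) (t : ℕ) (P : Grassmannian k d) :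
    ∫ Q, K t P Q ∂(sigma hkd) = lam hkd t := by
  have h : ∀ P', ∫ Q, K t P' Q ∂(sigma hkd) = ∫ Q, K t P Q ∂(sigma hkd) := by
    intro P'
    obtain ⟨U, rfl⟩ := exists_conj_eq P P'
    conv_lhs => rw [← map_conj_sigma hkd U]
    rw [integral_map (continuous_conj_right U).measurable.aemeasurable
      (continuous_K t _).measurable.aestronglyMeasurable]
    simp only [K_conj_conj]
  rw [lam]
  simp [h]

end Topology

/-! ### The feature map and the cubature error -/

section FeatureMap

variable {k d : ℕ}

/-- The space `(ℝ^{d × d})^{⊗ t}` of tensors, with its Euclidean norm. -/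
abbrev Tensor (d t : ℕ) : Type := EuclideanSpace ℝ (Fin t → Fin d × Fin d)

/-- The tensor power `P^{⊗ t}`, a feature map of the kernel `K_t`. -/
noncomputable def feature (t : ℕ) (P : Grassmannian k d) : Tensor d t :=
  WithLp.toLp 2 fun i => ∏ l, P.1 (i l).1 (i l).2

/-- By symmetry `trace (P Q)` is the entrywise inner product; its `t`-th power expands over
`t`-tuples of index pairs. -/
theorem inner_feature (t : ℕ) (P Q : Grassmannian k d) :
    inner ℝ (feature t P) (feature t Q) = K t P Q := by
  have htr : (P.1 * Q.1).trace = ∑ ij : Fin d × Fin d, P.1 ij.1 ij.2 * Q.1 ij.1 ij.2 := by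
    rw [Matrix.trace, Fintype.sum_prod_type]
    refine Finset.sum_congr rfl fun i _ => ?_
    rw [Matrix.diag_apply, Matrix.mul_apply]
    refine Finset.sum_congr rfl fun j _ => ?_
    rw [show Q.1 j i = Q.1 i j from congrFun (congrFun Q.2.1 i) j]
  rw [K, htr, Finset.sum_pow', PiLp.inner_apply]
  simp only [Fintype.piFinset_univ, feature, Finset.prod_mul_distrib]
  refine Finset.sum_congr rfl fun i _ => ?_
  simp [mul_comm]

theorem continuous_feature (t : ℕ) : Continuous (feature t : Grassmannian k d → Tensor d t) := by
  refine (PiLp.continuous_toLp 2 _).comp (continuous_pi fun i => ?_)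
  exact continuous_finsetProd _ fun l _ => continuous_entry _ _

theorem feature_coord_mem_Pol (t : ℕ) (i : Fin t → Fin d × Fin d) :
    (fun P : Grassmannian k d => feature t P i) ∈ Pol k d t := by
  refine ⟨∏ l, MvPolynomial.X (i l), ?_, ?_⟩
  · rw [SetLike.mem_coe, MvPolynomial.mem_restrictTotalDegree]
    refine (MvPolynomial.totalDegree_finsetProd _ _).trans ?_
    simp [MvPolynomial.totalDegree_X]
  · ext P
    simp [feature]

theorem inner_feature_mem_Pol (t : ℕ) (v : Tensor d t) :
    (fun P : Grassmannian k d => inner ℝ v (feature t P)) ∈ Pol k d t := by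
  have h : (fun P : Grassmannian k d => inner ℝ v (feature t P)) =
      ∑ i, v i • fun P : Grassmannian k d => feature t P i := by
    ext P
    simp [PiLp.inner_apply, mul_comm]
  rw [h]
  exact Submodule.sum_mem _ fun i _ => Submodule.smul_mem _ _ (feature_coord_mem_Pol t i)

/-- The mean `∫ P^{⊗ t} dσ_{k,d}(P)`. -/
noncomputable def meanFeature (hkd : k ≤ d) (t : ℕ) : Tensor d t :=
  ∫ Q, feature t Q ∂(sigma hkd)

theorem inner_meanFeature (hkd : k ≤ d) (t : ℕ) (v : Tensor d t) :
    inner ℝ v (meanFeature hkd t) = ∫ Q, inner ℝ v (feature t Q) ∂(sigma hkd) :=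
  (integral_inner (integrable_of_continuous (continuous_feature t) _) v).symm

theorem integral_feature_eq {hkd : k ≤ d} {t : ℕ} {ν : Measure (Grassmannian k d)}
    (hν : IsProbabilisticCubature hkd t ν) : ∫ Q, feature t Q ∂ν = meanFeature hkd t := by
  have := hν.isProbabilityMeasure
  refine ext_inner_left ℝ fun v => ?_
  rw [inner_meanFeature, ← hν.integral_eq _ (inner_feature_mem_Pol t v)]
  exact (integral_inner (integrable_of_continuous (continuous_feature t) _) v).symm

/-- Each feature has squared norm `k^t` and inner product `λ_t` with the mean, whose own squared
norm is `λ_t`. -/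
theorem norm_feature_sub_meanFeature_sq (hkd : k ≤ d) (t : ℕ) (P : Grassmannian k d) :
    ‖feature t P - meanFeature hkd t‖ ^ 2 = (k : ℝ) ^ t - lam hkd t := by
  have h1 : ∀ P : Grassmannian k d, inner ℝ (feature t P) (meanFeature hkd t) = lam hkd t := by
    intro P
    rw [inner_meanFeature]
    simp only [inner_feature]
    exact integral_K_eq_lam hkd t P
  have h2 : inner ℝ (meanFeature hkd t) (meanFeature hkd t) = lam hkd t := by
    rw [inner_meanFeature]
    simp [real_inner_comm, h1]
  rw [norm_sub_sq_real, h1, ← real_inner_self_eq_norm_sq, ← real_inner_self_eq_norm_sq,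
    inner_feature, K_self, h2]
  ring

theorem kernelSum_eq_inner (t : ℕ) (α : Grassmannian k d →₀ ℝ) (Q : Grassmannian k d) :
    kernelSum t α Q = inner ℝ (α.sum fun P a => a • feature t P) (feature t Q) := by
  simp [kernelSum, Finsupp.sum, sum_inner, real_inner_smul_left, inner_feature]

theorem kernelPairing_self (t : ℕ) (α : Grassmannian k d →₀ ℝ) :
    kernelPairing t α α = ‖α.sum fun P a => a • feature t P‖ ^ 2 := by
  rw [kernelPairing_right, ← real_inner_self_eq_norm_sq]
  simp only [kernelSum_eq_inner]
  conv_rhs => rw [Finsupp.sum, inner_sum]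
  simp [Finsupp.sum, real_inner_smul_right]

/-- A function of nonzero kernel norm is a linear functional of the feature map. -/
theorem exists_inner_feature_of_kernelNorm_eq_one {t : ℕ} {f : Grassmannian k d → ℝ}
    (hf : kernelNorm t f = 1) :
    ∃ v : Tensor d t, ‖v‖ = 1 ∧ ∀ Q, f Q = inner ℝ v (feature t Q) := by
  -- `kernelInner` is 0 off the kernel sums, so norm 1 forces `f` to be one; the spanning of `Pol`
  -- by kernels is not needed.
  have hex : ∃ α, kernelSum t α = f := by
    by_contra h
    rw [kernelNorm, kernelInner, dif_neg fun h' => h h'.1, Real.sqrt_zero] at hf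
    exact zero_ne_one hf
  obtain ⟨α, rfl⟩ := hex
  refine ⟨α.sum fun P a => a • feature t P, ?_, kernelSum_eq_inner t α⟩
  rwa [kernelNorm, kernelInner_eq, kernelPairing_self, Real.sqrt_sq (norm_nonneg _)] at hf

theorem isApproxCubature_of_norm_le (hkd : k ≤ d) (t : ℕ) {n : ℕ} (hn : 1 ≤ n)
    (P : Fin n → Grassmannian k d) {ε : ℝ}
    (h : ‖∑ j, (feature t (P j) - meanFeature hkd t)‖ ≤ n * ε) :
    IsApproxCubature hkd t P (fun _ => 1 / (n : ℝ)) ε := by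
  intro f _ hf
  obtain ⟨v, hv, hfv⟩ := exists_inner_feature_of_kernelNorm_eq_one hf
  have hn' : (0 : ℝ) < n := by exact_mod_cast hn
  have heq : ∑ j, 1 / (n : ℝ) * f (P j) - ∫ Q, f Q ∂(sigma hkd) =
      1 / n * inner ℝ v (∑ j, (feature t (P j) - meanFeature hkd t)) := by
    simp only [hfv, ← inner_meanFeature, inner_sum, inner_sub_right, Finset.sum_sub_distrib,
      Finset.sum_const, Finset.card_univ, Fintype.card_fin, ← Nat.cast_smul_eq_nsmul ℝ,
      real_inner_smul_right, ← Finset.mul_sum]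
    field_simp
  rw [heq, abs_mul, abs_of_pos (by positivity), one_div, inv_mul_le_iff₀ hn']
  refine (abs_real_inner_le_norm _ _).trans ?_
  rwa [hv, one_mul]

/-- An arbitrary intersection of closed conditions is closed, so no countable family of test
functions is needed. -/
theorem measurableSet_isApproxCubature (hkd : k ≤ d) (t : ℕ) {n : ℕ} (ω : Fin n → ℝ) (ε : ℝ) :
    MeasurableSet {P : Fin n → Grassmannian k d | IsApproxCubature hkd t P ω ε} := by
  refine IsClosed.measurableSet ?_
  have h : {P : Fin n → Grassmannian k d | IsApproxCubature hkd t P ω ε} =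
      ⋂ f ∈ Pol k d t, ⋂ (_ : kernelNorm t f = 1),
        {P | |∑ j, ω j * f (P j) - ∫ Q, f Q ∂(sigma hkd)| ≤ ε} := by
    ext P; simp [IsApproxCubature]
  rw [h]
  refine isClosed_biInter fun f hf => isClosed_iInter fun _ => ?_
  have := continuous_of_mem_Pol hf
  exact isClosed_le (by fun_prop) continuous_const

end FeatureMap

end GrassmannCubature

/-! ### Comparison of exponents and conclusion -/

namespace GrassmannCubature

theorem one_le_rTau {k d : ℕ} (hkd : k ≤ d) (t : ℕ) (τ : ℝ) (n : ℕ) : 1 ≤ rTau hkd t τ n := by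
  rw [rTau]
  split_ifs
  · exact le_rfl
  · have : (0 : ℝ) ≤ 6 / (n * τ ^ 2 *
        Real.log (1 + τ / (Real.sqrt n * (1 - lam hkd t / (k : ℝ) ^ t))) ^ 2) := by positivity
    linarith

theorem lam_le {k d : ℕ} (hkd : k ≤ d) (t : ℕ) : lam hkd t ≤ (k : ℝ) ^ t := by
  have := norm_feature_sub_meanFeature_sq hkd t (baseProj hkd)
  linarith [sq_nonneg ‖feature t (baseProj hkd) - meanFeature hkd t‖]

/-- Dropping `τ / (3√n)` from the denominator gives `τ² k^t / (2 (k^t - λ_t))`; the right side is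
larger by exactly `1/2`. -/
theorem Psi_le {k d : ℕ} (hk : 1 ≤ k) (hkd : k ≤ d) (t : ℕ) {τ : ℝ} (hτ : 0 < τ) (n : ℕ)
    (hlam : lam hkd t < (k : ℝ) ^ t) :
    Psi hkd t τ n ≤
      ((1 + τ ^ 2) * (k : ℝ) ^ t - lam hkd t) / (2 * ((k : ℝ) ^ t - lam hkd t)) := by
  have hkt : (0 : ℝ) < (k : ℝ) ^ t := by positivity
  have hs : 0 < 1 - lam hkd t / (k : ℝ) ^ t := by
    rw [sub_pos, div_lt_one hkt]; exact hlam
  have hc : 0 < (k : ℝ) ^ t - lam hkd t := sub_pos.mpr hlam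
  calc Psi hkd t τ n ≤ τ ^ 2 / 2 / (1 - lam hkd t / (k : ℝ) ^ t) := by
        rw [Psi]
        gcongr
        exact le_add_of_nonneg_right (by positivity)
    _ = τ ^ 2 * (k : ℝ) ^ t / (2 * ((k : ℝ) ^ t - lam hkd t)) := by
        rw [one_sub_div hkt.ne']; field_simp
    _ ≤ _ := by
        gcongr
        linarith

end GrassmannCubature
open GrassmannCubature in
theorem mainTheorem12 {k d : ℕ} (hk : 1 ≤ k) (hkd : k ≤ d) (t n : ℕ) (hn : 1 ≤ n)
    (τ : ℝ) (hτ : 0 < τ)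
    (ν : Measure (Grassmannian k d)) (hν : IsProbabilisticCubature hkd t ν)
    {Ω : Type*} [MeasurableSpace Ω] (μ : Measure Ω) [IsProbabilityMeasure μ]
    (P : Fin n → Ω → Grassmannian k d) (hP : ∀ j, Measurable (P j))
    (hindep : iIndepFun P μ) (hlaw : ∀ j, μ.map (P j) = ν) :
    MeasurableSet {x | IsApproxCubature hkd t (fun j => P j x) (fun _ => 1 / (n : ℝ))
        (Real.sqrt (((1 + τ ^ 2) * (k : ℝ) ^ t - lam hkd t) / n))} ∧
      1 - 4 * Real.exp (-Psi hkd t τ n) * rTau hkd t τ n ≤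
        μ.real {x | IsApproxCubature hkd t (fun j => P j x) (fun _ => 1 / (n : ℝ))
          (Real.sqrt (((1 + τ ^ 2) * (k : ℝ) ^ t - lam hkd t) / n))} := by
  set ε : ℝ := Real.sqrt (((1 + τ ^ 2) * (k : ℝ) ^ t - lam hkd t) / n) with hε
  set A : Set Ω := {x | IsApproxCubature hkd t (fun j => P j x) (fun _ => 1 / (n : ℝ)) ε} with hA_def
  have hA : MeasurableSet A :=
    (measurable_pi_lambda (fun x j => P j x) hP) (measurableSet_isApproxCubature hkd t _ ε)
  refine ⟨hA, ?_⟩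
  have hn' : (0 : ℝ) < n := by exact_mod_cast hn
  have hkt : (0 : ℝ) < (k : ℝ) ^ t := by positivity
  have hlam := lam_le hkd t
  have hnum : 0 < (1 + τ ^ 2) * (k : ℝ) ^ t - lam hkd t := by
    have : 0 < τ ^ 2 * (k : ℝ) ^ t := by positivity
    linarith
  have hε0 : 0 < ε := Real.sqrt_pos.mpr (by positivity)
  have hε2 : ε ^ 2 = ((1 + τ ^ 2) * (k : ℝ) ^ t - lam hkd t) / n := Real.sq_sqrt (by positivity)
  let Y : Fin n → Ω → Tensor d t := fun j x => feature t (P j x) - meanFeature hkd t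
  have hsub : Aᶜ ⊆ {x | n * ε ≤ ‖∑ j, Y j x‖} := fun x hx => by
    by_contra h
    exact hx (isApproxCubature_of_norm_le hkd t hn _ (not_le.mp h).le)
  have hexp : 0 < Real.exp (-Psi hkd t τ n) := Real.exp_pos _
  suffices hbad : μ.real {x | n * ε ≤ ‖∑ j, Y j x‖} ≤ 4 * Real.exp (-Psi hkd t τ n) by
    have h1 := measureReal_mono (μ := μ) hsub
    rw [probReal_compl_eq_one_sub hA] at h1
    have h2 := le_mul_of_one_le_right (by positivity : 0 ≤ 4 * Real.exp (-Psi hkd t τ n))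
      (one_le_rTau hkd t τ n)
    linarith
  have hYn : ∀ j x, ‖Y j x‖ ^ 2 = (k : ℝ) ^ t - lam hkd t := fun j x =>
    norm_feature_sub_meanFeature_sq hkd t (P j x)
  rcases hlam.eq_or_lt with heq | hlt
  -- Here `c = 0`, which the tail bound excludes; but all centred features vanish while `n ε > 0`.
  · have hY0 : ∀ x j, Y j x = 0 := fun x j => by
      have := hYn j x
      rwa [heq, sub_self, sq_eq_zero_iff, norm_eq_zero] at this
    have hempty : {x | n * ε ≤ ‖∑ j, Y j x‖} = ∅ := by
      refine Set.eq_empty_of_forall_notMem fun x hx => ?_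
      simp only [Set.mem_ofPred_eq, hY0, Finset.sum_const_zero, norm_zero] at hx
      exact absurd hx (not_le.mpr (by positivity))
    rw [hempty, measureReal_empty]
    positivity
  · set c : ℝ := Real.sqrt ((k : ℝ) ^ t - lam hkd t) with hc_def
    have hc : 0 < c := Real.sqrt_pos.mpr (sub_pos.mpr hlt)
    have hc2 : c ^ 2 = (k : ℝ) ^ t - lam hkd t := Real.sq_sqrt (sub_pos.mpr hlt).le
    have hg : Measurable fun Q : Grassmannian k d => feature t Q - meanFeature hkd t :=
      ((continuous_feature t).sub continuous_const).measurable
    have hνp := hν.isProbabilityMeasure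
    have hmean : ∀ j, ∫ x, Y j x ∂μ = 0 := fun j => by
      have h := integral_map (μ := μ) (hP j).aemeasurable
        (f := fun Q => feature t Q - meanFeature hkd t) hg.aestronglyMeasurable
      rw [hlaw j, integral_sub (integrable_of_continuous (continuous_feature t) ν)
        (integrable_const _), integral_feature_eq hν] at h
      simpa using h.symm
    have hbound := measureReal_norm_sum_ge_le (μ := μ) hn (fun j => hg.comp (hP j))
      (hindep.comp (fun _ => _) fun _ => hg) (r := n * ε) (by positivity) hc
      (fun j x => by rw [hc_def, ← hYn j x, Real.sqrt_sq (norm_nonneg _)]; rfl) hmean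
    have hexpo : (n * ε) ^ 2 / (2 * n * c ^ 2) =
        ((1 + τ ^ 2) * (k : ℝ) ^ t - lam hkd t) / (2 * ((k : ℝ) ^ t - lam hkd t)) := by
      have : (k : ℝ) ^ t - lam hkd t ≠ 0 := (sub_pos.mpr hlt).ne'
      rw [mul_pow, hε2, hc2]
      field_simp
    rw [hexpo] at hbound
    refine hbound.trans ?_
    have := Real.exp_le_exp.mpr (neg_le_neg (Psi_le hk hkd t hτ n hlt))
    linarith
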